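/- For a commutative ring $A$ let $\mathrm{Q}(A)$ be its total ring of fractions and $\overline{A}$ the integral closure of $A$ in $\mathrm{Q}(A)$. For a ring extension $B/A$, the strict closure of $A$ in $B$ is $\{\alpha\in B \mid \alpha\otimes 1=1\otimes\alpha \text{ in } B\otimes_A B\}$, and $A$ is called strictly closed if it equals its strict closure in $\overline{A}$. Let $F$ be any field of characteristic $3$, let $K=\mathrm{Q}(F[t])=F(t)$ be the rational function field, and let $k=\mathrm{Q}(F[t^3])=F(t^3)\subseteq K$. Let $R=k[X,tX,t^2X]$, the $k$-subalgebra of the polynomial ring $K[X]$ generated by $X$, $tX$ and $t^2X$. Then: 1. $K=k[t]$, and $\{1,t,t^2\}$ is a $k$-basis of $K$. 2. $R$ is strictly closed, but $K\otimes_k R$ is not strictly closed. 3. $R$ and $K\otimes_k R$ are Noetherian, the canonical homomorphism $R\to K\otimes_k R$ is faithfully flat, $R$ is reduced, and $\overline{R}$ is a finitely generated $R$-module. In particular, for a faithfully flat homomorphism $R\to S$ of Noetherian rings with $R$ reduced and $\overline{R}$ finitely generated over $R$, strict closedness of $R$ does not imply strict closedness of $S$ without a further hypothesis (such as regularity of the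 fibres). -/

import Mathlib

open scoped Polynomial TensorProduct

universe u v

/-- The strict closure of `R` in an `R`-algebra `S`: the elements `α` of `S` such that
`α ⊗ 1 = 1 ⊗ α` in `S ⊗[R] S`. It is an `R`-subalgebra of `S`. -/
def strictClosure (R : Type u) (S : Type v) [CommRing R] [CommRing S] [Algebra R S] :
    Subalgebra R S where
  carrier := {α | α ⊗ₜ[R] (1 : S) = (1 : S) ⊗ₜ[R] α}
  mul_mem' {a b} ha hb := by
    have h : (a ⊗ₜ[R] (1 : S)) * (b ⊗ₜ[R] (1 : S)) = ((1 : S) ⊗ₜ[R] a) * ((1 : S) ⊗ₜ[R] b) := by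
      rw [show a ⊗ₜ[R] (1 : S) = (1 : S) ⊗ₜ[R] a from ha,
        show b ⊗ₜ[R] (1 : S) = (1 : S) ⊗ₜ[R] b from hb]
    simpa using h
  add_mem' {a b} ha hb := by
    change (a + b) ⊗ₜ[R] (1 : S) = (1 : S) ⊗ₜ[R] (a + b)
    rw [TensorProduct.add_tmul, TensorProduct.tmul_add,
      show a ⊗ₜ[R] (1 : S) = (1 : S) ⊗ₜ[R] a from ha,
      show b ⊗ₜ[R] (1 : S) = (1 : S) ⊗ₜ[R] b from hb]
  algebraMap_mem' r := by
    change (algebraMap R S r) ⊗ₜ[R] (1 : S) = (1 : S) ⊗ₜ[R] (algebraMap R S r)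
    rw [Algebra.algebraMap_eq_smul_one, TensorProduct.smul_tmul]

/-- `R` is strictly closed in `S` if its strict closure in `S` is (the image of) `R` itself. -/
def IsStrictlyClosedIn (R : Type u) (S : Type v) [CommRing R] [CommRing S] [Algebra R S] : Prop :=
  strictClosure R S = ⊥

/-- The integral closure of `R` in its total ring of fractions `FractionRing R`, the localization
of `R` at the set of all its non-zerodivisors. -/
abbrev totalIntegralClosure (R : Type u) [CommRing R] : Subalgebra R (FractionRing R) :=
  integralClosure R (FractionRing R)

/-- `R` is strictly closed if it is strictly closed in its integral closure in its total ring of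
fractions. -/
def IsStrictlyClosed (R : Type u) [CommRing R] : Prop :=
  IsStrictlyClosedIn R (totalIntegralClosure R)

section Construction

variable (F : Type u) [Field F]

/-- The subfield `k = Q(F[t³])` of the rational function field `K = RatFunc F = Q(F[t])`,
i.e. the field of fractions, inside `K`, of the subring `F[t³]`. -/
noncomputable abbrev cubeSubfield : IntermediateField F (RatFunc F) :=
  IntermediateField.adjoin F {(RatFunc.X : RatFunc F) ^ 3}

/-- The `k`-subalgebra `k[X, tX, t²X]` of the polynomial ring `K[X]`. -/
noncomputable def cubeRing : Subalgebra (cubeSubfield F) (RatFunc F)[X] :=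
  Algebra.adjoin (cubeSubfield F)
    {Polynomial.X,
      Polynomial.C (RatFunc.X : RatFunc F) * Polynomial.X,
      Polynomial.C ((RatFunc.X : RatFunc F) ^ 2) * Polynomial.X}

end Construction

/-! ### Strict closures -/

/-! The ring `R` is `k + X K[X]`, with normalization `K[X]` (`mem_cubeRing_iff`,
`totalIntegralClosureEquivPolynomial`). If `f(0) ∉ k`, a `k`-linear functional on `K` killing `1`
but not `f(0)` separates `f ⊗ 1` from `1 ⊗ f`, so `R` is strictly closed. In `K ⊗ R` the element `y
= t ⊗ X - 1 ⊗ tX` has cube zero, since `t³ ∈ k` and the characteristic is `3`. With `x = 1 ⊗ X`, the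
nilpotent fraction `y / x²` is integral, which forces `y² / x²` into the strict closure. That
element is `(t ⊗ 1 - 1 ⊗ t)²`, a constant outside `K ⊗ k`, hence not in `K ⊗ R`. -/

theorem IsStrictlyClosedIn.of_algEquiv {R : Type*} {S : Type u} {T : Type v} [CommRing R]
    [CommRing S] [CommRing T] [Algebra R S] [Algebra R T] (e : S ≃ₐ[R] T)
    (h : IsStrictlyClosedIn R T) : IsStrictlyClosedIn R S := by
  refine eq_bot_iff.2 fun s hs ↦ ?_
  have hes : e s ∈ strictClosure R T := by
    have := congrArg (Algebra.TensorProduct.map (e : S →ₐ[R] T) (e : S →ₐ[R] T))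
      (show s ⊗ₜ[R] (1 : S) = (1 : S) ⊗ₜ[R] s from hs)
    simp only [Algebra.TensorProduct.map_tmul, map_one] at this
    exact this
  rw [show strictClosure R T = ⊥ from h, Algebra.mem_bot] at hes
  obtain ⟨r, hr⟩ := hes
  exact Algebra.mem_bot.2 ⟨r, e.injective (by rw [e.commutes, hr])⟩

/-- Think of `d` as `y / x`: then `yd ⊗ 1 = d ⊗ xd = xd ⊗ d = 1 ⊗ yd`, so `y² / x` is in the strict
closure. -/
theorem tmul_one_eq_one_tmul_mul {R S : Type*} [CommRing R] [CommRing S] [Algebra R S]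
    {x y : R} {d : S} (h : x • d = algebraMap R S y) :
    (y • d) ⊗ₜ[R] (1 : S) = (1 : S) ⊗ₜ[R] (y • d) := by
  rw [Algebra.algebraMap_eq_smul_one] at h
  calc (y • d) ⊗ₜ[R] (1 : S) = d ⊗ₜ[R] (y • (1 : S)) := by rw [TensorProduct.smul_tmul]
    _ = (x • d) ⊗ₜ[R] d := by rw [← h, TensorProduct.smul_tmul]
    _ = (1 : S) ⊗ₜ[R] (y • d) := by rw [h, TensorProduct.smul_tmul]

/-- If `x` is a non-zerodivisor and `y` is nilpotent, then `y² / x²` lies in the strict closure, so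
the ring is not strictly closed unless `x²` divides `y²`. -/
theorem not_isStrictlyClosed_of_isNilpotent {S : Type*} [CommRing S] {x y : S}
    (hx : x ∈ nonZeroDivisors S) (hy : IsNilpotent y) (h : ∀ s, s * x ^ 2 ≠ y ^ 2) :
    ¬ IsStrictlyClosed S := by
  intro hS
  have hx2 : x ^ 2 ∈ nonZeroDivisors S := pow_mem hx 2
  -- The denominator is `x ^ 2`, so that `y * q` is `y² / x²`.
  set q : FractionRing S := IsLocalization.mk' (FractionRing S) y ⟨x ^ 2, hx2⟩ with hq
  have hqx : algebraMap S (FractionRing S) (x ^ 2) * q = algebraMap S (FractionRing S) y := by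
    rw [hq, mul_comm]
    exact IsLocalization.mk'_spec (FractionRing S) y ⟨x ^ 2, hx2⟩
  have hqn : IsNilpotent q := by
    rw [hq, IsLocalization.mk'_eq_mul_mk'_one]
    exact (Commute.all _ _).isNilpotent_mul_right (hy.map (algebraMap S (FractionRing S)))
  have hqi : IsIntegral S q := by
    obtain ⟨n, hn⟩ := hqn
    exact ⟨Polynomial.X ^ n, Polynomial.monic_X_pow n, by simp [hn]⟩
  let d : totalIntegralClosure S := ⟨q, hqi⟩
  have hd : x ^ 2 • d = algebraMap S (totalIntegralClosure S) y := by
    apply Subtype.ext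
    change x ^ 2 • q = algebraMap S (FractionRing S) y
    rw [Algebra.smul_def, hqx]
  have hmem : y • d ∈ strictClosure S (totalIntegralClosure S) := tmul_one_eq_one_tmul_mul hd
  rw [show strictClosure S (totalIntegralClosure S) = ⊥ from hS, Algebra.mem_bot] at hmem
  obtain ⟨s, hs⟩ := hmem
  have hs' : algebraMap S (FractionRing S) s = y • q := congrArg Subtype.val hs
  apply h s
  apply IsFractionRing.injective S (FractionRing S)
  rw [map_mul, hs', Algebra.smul_def, mul_assoc, mul_comm q, hqx, ← map_mul, sq]

/-! ### Polynomials with constant term in a subfield -/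

section ConstantTerm

variable {k K : Type*} [Field k] [Field K] [Algebra k K] {R : Subalgebra k K[X]}

theorem isStrictlyClosedIn_of_coeff_zero
    (hR : ∀ f, f ∈ R ↔ f.coeff 0 ∈ (algebraMap k K).range) : IsStrictlyClosedIn R K[X] := by
  refine eq_bot_iff.2 fun f hf ↦ ?_
  have hf' : f.coeff 0 ∈ (algebraMap k K).range := by
    by_contra hf0
    obtain ⟨φ, hφ, hker⟩ := Submodule.exists_le_ker_of_notMem (K := k)
      (p := LinearMap.range (Algebra.linearMap k K)) hf0
    have hφ1 : φ 1 = 0 := hker ⟨1, by simp⟩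
    -- `B p q = φ(p(0)) q(0)` is balanced because `R` acts on constant terms through `k`, over which
    -- `φ` is linear.
    let ev : K[X] →+ K := (Polynomial.lcoeff K 0).toAddMonoidHom
    let B : K[X] →+ K[X] →+ K := (AddMonoidHom.mul.comp
      ((algebraMap k K : k →+ K).comp (φ.toAddMonoidHom.comp ev))).compl₂ ev
    have hB : ∀ p q, B p q = algebraMap k K (φ (p.coeff 0)) * q.coeff 0 := fun p q ↦ rfl
    have hbal : ∀ (r : R) (p q : K[X]), B (r • p) q = B p (r • q) := by
      intro r p q
      obtain ⟨e, he⟩ := (hR r).1 r.2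
      rw [hB, hB, Subalgebra.smul_def, Subalgebra.smul_def, smul_eq_mul, smul_eq_mul,
        Polynomial.mul_coeff_zero, Polynomial.mul_coeff_zero, ← he,
        ← Algebra.smul_def e (p.coeff 0), map_smul, smul_eq_mul, map_mul]
      ring
    have key : B f 1 = B 1 f := congrArg (TensorProduct.liftAddHom B hbal)
      (show f ⊗ₜ[R] (1 : K[X]) = (1 : K[X]) ⊗ₜ[R] f from hf)
    rw [hB, hB, Polynomial.coeff_one_zero, hφ1, map_zero, zero_mul, mul_one] at key
    exact hφ ((map_eq_zero _).1 key)
  exact Algebra.mem_bot.2 ⟨⟨f, (hR f).2 hf'⟩, rfl⟩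

theorem faithfullyFlat_includeRight {A B : Type u} [CommRing A] [CommRing B] [Algebra k A]
    [Algebra k B] [Nontrivial A] :
    (Algebra.TensorProduct.includeRight : B →ₐ[k] A ⊗[k] B).toRingHom.FaithfullyFlat := by
  have h : (algebraMap B (B ⊗[k] A)).FaithfullyFlat :=
    RingHom.faithfullyFlat_algebraMap_iff.2 inferInstance
  exact RingHom.FaithfullyFlat.stableUnderComposition _
    (Algebra.TensorProduct.comm k B A).toRingEquiv.toRingHom h
    (.of_bijective (Algebra.TensorProduct.comm k B A).bijective)

theorem isFractionRing_of_coeff_zero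
    (hR : ∀ f, f ∈ R ↔ f.coeff 0 ∈ (algebraMap k K).range) :
    IsFractionRing R (FractionRing K[X]) := by
  have hX : ∀ p : K[X], Polynomial.X * p ∈ R := fun p ↦ (hR _).2 ⟨0, by simp⟩
  refine IsFractionRing.of_field R (FractionRing K[X]) fun z ↦ ?_
  obtain ⟨a, b, hb, rfl⟩ := IsFractionRing.div_surjective (A := K[X]) z
  refine ⟨⟨_, hX a⟩, ⟨_, hX b⟩, ?_⟩
  have h0 : algebraMap K[X] (FractionRing K[X]) Polynomial.X ≠ 0 := by simp
  change _ = algebraMap K[X] _ (Polynomial.X * a) / algebraMap K[X] _ (Polynomial.X * b)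
  rw [map_mul, map_mul, mul_div_mul_left _ _ h0]

/-- Since `X K[X] ⊆ R`, a `k`-basis of the constants `K` generates `K[X]` over `R`. -/
theorem finite_polynomial_of_coeff_zero [FiniteDimensional k K]
    (hR : ∀ f, f ∈ R ↔ f.coeff 0 ∈ (algebraMap k K).range) : Module.Finite R K[X] := by
  have hX : ∀ p : K[X], Polynomial.X * p ∈ R := fun p ↦ (hR _).2 ⟨0, by simp⟩
  let b := Module.finBasis k K
  refine ⟨Submodule.fg_def.2 ⟨Set.range fun i ↦ Polynomial.C (b i), Set.finite_range _, ?_⟩⟩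
  set N := Submodule.span R (Set.range fun i ↦ Polynomial.C (b i)) with hN
  have hC : ∀ a : K, Polynomial.C a ∈ N := by
    intro a
    rw [← b.sum_repr a, map_sum]
    refine sum_mem fun i _ ↦ ?_
    have : Polynomial.C (b.repr a i • b i) = algebraMap k R (b.repr a i) • Polynomial.C (b i) := by
      rw [algebraMap_smul, Polynomial.smul_C]
    rw [this]
    exact N.smul_mem _ (Submodule.subset_span ⟨i, rfl⟩)
  rw [eq_top_iff]
  rintro p -
  rw [← Polynomial.X_mul_divX_add p]
  refine N.add_mem ?_ (hC _)
  have := N.smul_mem ⟨_, hX p.divX⟩ (hC 1)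
  simpa [Subalgebra.smul_def] using this

/-- The integral closure of the ring of polynomials with constant term in `k` is `K[X]`. -/
noncomputable def totalIntegralClosureEquivPolynomial [FiniteDimensional k K]
    (hR : ∀ f, f ∈ R ↔ f.coeff 0 ∈ (algebraMap k K).range) :
    totalIntegralClosure R ≃ₐ[R] K[X] :=
  haveI := isFractionRing_of_coeff_zero hR
  haveI := finite_polynomial_of_coeff_zero hR
  haveI : IsIntegralClosure K[X] R (FractionRing K[X]) :=
    IsIntegralClosure.of_isIntegrallyClosed K[X] R (FractionRing K[X])
  (FractionRing.algEquiv R (FractionRing K[X])).mapIntegralClosure.trans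
    (IsIntegralClosure.equiv R (integralClosure R (FractionRing K[X])) (FractionRing K[X]) K[X])

theorem isStrictlyClosed_of_coeff_zero [FiniteDimensional k K]
    (hR : ∀ f, f ∈ R ↔ f.coeff 0 ∈ (algebraMap k K).range) : IsStrictlyClosed R :=
  .of_algEquiv (totalIntegralClosureEquivPolynomial hR) (isStrictlyClosedIn_of_coeff_zero hR)

theorem finite_totalIntegralClosure_of_coeff_zero [FiniteDimensional k K]
    (hR : ∀ f, f ∈ R ↔ f.coeff 0 ∈ (algebraMap k K).range) :
    Module.Finite R (totalIntegralClosure R) :=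
  haveI := finite_polynomial_of_coeff_zero hR
  .equiv (totalIntegralClosureEquivPolynomial hR).symm.toLinearEquiv

/-- In characteristic `3`, for `t ∈ K` with `t³ ∈ k` and a functional `φ` on `K` with
`φ 1 = φ t = 0` and `φ t² = 1`, the element `(t ⊗ 1 - 1 ⊗ t)²` lies in the strict closure. -/
theorem not_isStrictlyClosed_tensorProduct [CharP K 3]
    (hR : ∀ f, f ∈ R ↔ f.coeff 0 ∈ (algebraMap k K).range) {t : K} {c : k}
    (ht : algebraMap k K c = t ^ 3) (φ : K →ₗ[k] k) (h0 : φ 1 = 0) (h1 : φ t = 0)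
    (h2 : φ (t ^ 2) = 1) : ¬ IsStrictlyClosed (K ⊗[k] R) := by
  have hX : ∀ a : K, Polynomial.C a * Polynomial.X ∈ R := fun p ↦ (hR _).2 ⟨0, by simp⟩
  have hX' : Polynomial.X ∈ R := (hR _).2 ⟨0, by simp⟩
  let x : R := ⟨_, hX'⟩
  let z : R := ⟨_, hX t⟩
  have h3 : (3 : K ⊗[k] R) = 0 := by
    have : (3 : K) = 0 := by exact_mod_cast CharP.cast_eq_zero K 3
    rw [← map_ofNat (algebraMap K (K ⊗[k] R)) 3, this, map_zero]
  refine not_isStrictlyClosed_of_isNilpotent (x := 1 ⊗ₜ[k] x) (y := t ⊗ₜ[k] x - 1 ⊗ₜ[k] z)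
    ?_ ⟨3, ?_⟩ fun s hs ↦ ?_
  · rw [mem_nonZeroDivisors_iff_right]
    intro s hs
    -- Multiplication by `X` is injective on `R` and stays so after the flat base change to `K`.
    have hinj : Function.Injective (LinearMap.mulRight k x) := fun a b hab ↦
      mul_right_cancel₀ (fun h ↦ Polynomial.X_ne_zero (congrArg Subtype.val h)) hab
    refine Module.Flat.lTensor_preserves_injective_linearMap (M := K) _ hinj ?_
    rw [map_zero, ← hs]
    clear hs
    induction s with
    | zero => simp
    | tmul a r => simp
    | add a b ha hb => rw [map_add, ha, hb, add_mul]
  · have hz : z ^ 3 = c • x ^ 3 := by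
      apply Subtype.ext
      change (Polynomial.C t * Polynomial.X) ^ 3 = c • (Polynomial.X : K[X]) ^ 3
      rw [mul_pow, ← map_pow, ← ht, Algebra.smul_def]
      rfl
    have htc : t ^ 3 = c • (1 : K) := by rw [← ht, Algebra.algebraMap_eq_smul_one]
    have hcube : (t ⊗ₜ[k] x) ^ 3 = ((1 : K) ⊗ₜ[k] z) ^ 3 := by
      simp only [Algebra.TensorProduct.tmul_pow, one_pow]
      rw [hz, htc, TensorProduct.smul_tmul]
    linear_combination hcube + (t ⊗ₜ[k] x * (1 ⊗ₜ[k] z) ^ 2 - (t ⊗ₜ[k] x) ^ 2 * 1 ⊗ₜ[k] z) * h3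
  -- `Ψ` applies `φ` to the coefficient of `X²`. On multiples of `x²` that coefficient comes from
  -- constant terms, in `k`, so `Ψ` vanishes; on `y²` only `φ(t²) = 1` survives.
  · let ψ : R →ₗ[k] k := φ ∘ₗ (Polynomial.lcoeff K 2).restrictScalars k ∘ₗ R.val.toLinearMap
    let Ψ : K ⊗[k] R →ₗ[k] K := (TensorProduct.rid k K).toLinearMap ∘ₗ ψ.lTensor K
    have hΨ : ∀ (a : K) (r : R), Ψ (a ⊗ₜ r) = φ ((r : K[X]).coeff 2) • a := fun a r ↦ rfl
    have hL : Ψ (s * (1 ⊗ₜ[k] x) ^ 2) = 0 := by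
      clear hs
      induction s with
      | zero => simp
      | tmul a r =>
        obtain ⟨e, he⟩ := (hR r).1 r.2
        rw [Algebra.TensorProduct.tmul_pow, Algebra.TensorProduct.tmul_mul_tmul, hΨ]
        have : ((r * x ^ 2 : R) : K[X]).coeff 2 = e • 1 := by
          rw [← Algebra.algebraMap_eq_smul_one, he]
          exact Polynomial.coeff_mul_X_pow (r : K[X]) 2 0
        rw [this, map_smul, h0, smul_zero, zero_smul]
      | add a b ha hb => rw [add_mul, map_add, ha, hb, add_zero]
    have hRt : Ψ ((t ⊗ₜ[k] x - 1 ⊗ₜ[k] z) ^ 2) = 1 := by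
      have hxx : ((x * x : R) : K[X]).coeff 2 = 1 := by simp [x, ← sq]
      have hxz : ((x * z : R) : K[X]).coeff 2 = t := by
        simp [x, z]
      have hzz : ((z * z : R) : K[X]).coeff 2 = t ^ 2 := by
        simp [z, ← sq, mul_pow, ← map_pow]
      have hexp : (t ⊗ₜ[k] x - 1 ⊗ₜ[k] z) ^ 2 = (t * t) ⊗ₜ[k] (x * x)
          - (2 : k) • (t ⊗ₜ[k] (x * z)) + (1 : K) ⊗ₜ[k] (z * z) := by
        have h1 := Algebra.TensorProduct.tmul_mul_tmul (R := k) t t x x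
        have h2 := Algebra.TensorProduct.tmul_mul_tmul (R := k) t 1 x z
        have h3 := Algebra.TensorProduct.tmul_mul_tmul (R := k) (1 : K) 1 z z
        rw [mul_one] at h2 h3
        rw [← h1, ← h2, ← h3, two_smul]
        ring
      rw [hexp, map_add, map_sub, map_smul, hΨ, hΨ, hΨ, hxx, hxz, hzz, h0, h1, h2]
      simp
    rw [hs, hRt] at hL
    exact one_ne_zero hL

end ConstantTerm

/-! ### The purely inseparable extension `F(t) / F(t³)` -/

section RatFunc

variable (F : Type u) [Field F]

theorem finrank_cubeSubfield : Module.finrank (cubeSubfield F) (RatFunc F) = 3 := by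
  have h : (RatFunc.X : RatFunc F) ^ 3 = algebraMap F[X] (RatFunc F) (Polynomial.X ^ 3) := by simp
  rw [RatFunc.finrank_eq_max_natDegree, h, RatFunc.num_algebraMap, RatFunc.denom_algebraMap]
  simp

instance : FiniteDimensional (cubeSubfield F) (RatFunc F) :=
  FiniteDimensional.of_finrank_pos (by rw [finrank_cubeSubfield]; norm_num)

theorem exists_basis_cubeSubfield :
    ∃ b : Module.Basis (Fin 3) (cubeSubfield F) (RatFunc F),
      ∀ i : Fin 3, b i = (RatFunc.X : RatFunc F) ^ (i : ℕ) := by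
  have hd : (minpoly (cubeSubfield F) (RatFunc.X : RatFunc F)).natDegree = 3 := by
    rw [← IntermediateField.adjoin.finrank (IsIntegral.of_finite _ _),
      RatFunc.IntermediateField.adjoin_X, IntermediateField.finrank_top', finrank_cubeSubfield]
  have hli := linearIndependent_pow (K := cubeSubfield F) (RatFunc.X : RatFunc F)
  rw [hd] at hli
  exact ⟨basisOfLinearIndependentOfCardEqFinrank hli (by simp [finrank_cubeSubfield]),
    fun i ↦ by simp⟩

theorem adjoin_ratFuncX_eq_top :
    Algebra.adjoin (cubeSubfield F) {(RatFunc.X : RatFunc F)} = ⊤ := by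
  obtain ⟨b, hb⟩ := exists_basis_cubeSubfield F
  rw [eq_top_iff]
  rintro z -
  rw [← b.sum_repr z]
  exact sum_mem fun i _ ↦ Subalgebra.smul_mem _
    (hb i ▸ pow_mem (Algebra.self_mem_adjoin_singleton _ _) _) _

theorem mem_cubeRing_iff (f : (RatFunc F)[X]) :
    f ∈ cubeRing F ↔ f.coeff 0 ∈ (algebraMap (cubeSubfield F) (RatFunc F)).range := by
  constructor
  · intro hf
    induction hf using Algebra.adjoin_induction with
    | mem x hx =>
      obtain rfl | rfl | rfl := hx <;> exact ⟨0, by simp⟩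
    | algebraMap r => exact ⟨r, by simp [Polynomial.algebraMap_apply]⟩
    | add x y _ _ hx hy => rw [Polynomial.coeff_add]; exact add_mem hx hy
    | mul x y _ _ hx hy => rw [Polynomial.mul_coeff_zero]; exact mul_mem hx hy
  · rintro ⟨c, hc⟩
    obtain ⟨b, hb⟩ := exists_basis_cubeSubfield F
    have hX : Polynomial.X ∈ cubeRing F := Algebra.subset_adjoin (by simp)
    have hbX : ∀ i, Polynomial.C (b i) * Polynomial.X ∈ cubeRing F := by
      intro i
      rw [hb]
      fin_cases i <;> exact Algebra.subset_adjoin (by simp)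
    have haX : ∀ a : RatFunc F, Polynomial.C a * Polynomial.X ∈ cubeRing F := by
      intro a
      rw [← b.sum_repr a, map_sum, Finset.sum_mul]
      refine sum_mem fun i _ ↦ ?_
      rw [← Polynomial.smul_C, smul_mul_assoc]
      exact Subalgebra.smul_mem _ (hbX i) _
    rw [f.as_sum_range_C_mul_X_pow]
    refine sum_mem fun n _ ↦ ?_
    cases n with
    | zero =>
      rw [← hc, pow_zero, mul_one]
      exact (cubeRing F).algebraMap_mem c
    -- `a Xⁿ⁺¹ = (a X) Xⁿ`, and `a X` is a `k`-combination of the three generators.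
    | succ n =>
      rw [pow_succ', ← mul_assoc]
      exact mul_mem (haX _) (pow_mem hX n)

theorem finiteType_cubeRing : Algebra.FiniteType (cubeSubfield F) (cubeRing F) :=
  (Subalgebra.fg_iff_finiteType _).1 (Subalgebra.fg_def.2 ⟨_, Set.toFinite _, rfl⟩)

end RatFunc

theorem mainTheorem8 (F : Type u) [Field F] [CharP F 3] :
    -- `K = k[t]`, and `1, t, t²` is a `k`-basis of `K`
    (Algebra.adjoin (cubeSubfield F) {(RatFunc.X : RatFunc F)} = ⊤ ∧
      ∃ b : Module.Basis (Fin 3) (cubeSubfield F) (RatFunc F),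
        ∀ i : Fin 3, b i = (RatFunc.X : RatFunc F) ^ (i : ℕ)) ∧
    -- `R` is strictly closed, but `K ⊗[k] R` is not
    (IsStrictlyClosed (cubeRing F) ∧
      ¬ IsStrictlyClosed (RatFunc F ⊗[cubeSubfield F] cubeRing F)) ∧
    -- `R → K ⊗[k] R` is a faithfully flat homomorphism of Noetherian rings, `R` is reduced, and
    -- the integral closure of `R` is a finite `R`-module
    (IsNoetherianRing (cubeRing F) ∧
      IsNoetherianRing (RatFunc F ⊗[cubeSubfield F] cubeRing F) ∧
      (Algebra.TensorProduct.includeRight :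
        cubeRing F →ₐ[cubeSubfield F]
          RatFunc F ⊗[cubeSubfield F] cubeRing F).toRingHom.FaithfullyFlat ∧
      IsReduced (cubeRing F) ∧
      Module.Finite (cubeRing F) (totalIntegralClosure (cubeRing F))) := by
  have hR := mem_cubeRing_iff F
  have hft := finiteType_cubeRing F
  obtain ⟨b, hb⟩ := exists_basis_cubeSubfield F
  have hchar : CharP (RatFunc F) 3 := charP_of_injective_algebraMap (algebraMap F _).injective 3
  refine ⟨⟨adjoin_ratFuncX_eq_top F, b, hb⟩, ⟨isStrictlyClosed_of_coeff_zero hR, ?_⟩,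
    Algebra.FiniteType.isNoetherianRing (cubeSubfield F) _,
    Algebra.FiniteType.isNoetherianRing (RatFunc F) _, faithfullyFlat_includeRight, inferInstance,
    finite_totalIntegralClosure_of_coeff_zero hR⟩
  · refine not_isStrictlyClosed_tensorProduct hR (t := RatFunc.X)
      (c := ⟨RatFunc.X ^ 3, IntermediateField.mem_adjoin_simple_self _ _⟩) rfl (b.coord 2) ?_ ?_ ?_
    · rw [show (1 : RatFunc F) = b 0 by simp [hb]]
      simp
    · rw [show (RatFunc.X : RatFunc F) = b 1 by simp [hb]]
      simp
    · rw [show (RatFunc.X : RatFunc F) ^ 2 = b 2 by simp [hb]]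
      simp
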